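/- Let $U$ and $V$ be random variables with values in $\mathbb{R}^p$ and $\mathbb{R}^q$, each almost surely contained in a compact set, and neither almost surely constant. Let $(U_i,V_i)_{i\ge 0}$ be an i.i.d. sequence with the law of $(U,V)$. The Hirschfeld–Gebelein–Rényi maximal correlation is $$HGR(U,V)=\sup_{f,g}\rho(f(U),g(V)),\qquad \rho(X,Y)=\frac{\mathrm{Cov}(X,Y)}{\sigma_X\sigma_Y},$$ the supremum being over measurable $f:\mathbb{R}^p\to\mathbb{R}$ and $g:\mathbb{R}^q\to\mathbb{R}$ such that $f(U)$ and $g(V)$ have positive and finite variance. Let $\sigma:\mathbb{R}\to\mathbb{R}$ be a continuous squashing function (nondecreasing, with limits $0$ at $-\infty$ and $1$ at $+\infty$). For input dimension $d$ and $m$ hidden units, the feedforward network with parameters $\theta=(a,b,c)\in(\mathbb{R}^d)^m\times\mathbb{R}^m\times\mathbb{R}^m$ is the function $x\mapsto\sum_{j=1}^m c_j\,\sigma(\langle a_j,x\rangle+b_j)$. Write $f_{\theta_f}$ for such a network on $\mathbb{R}^p$ with $m$ hidden units, and $g_{\theta_g}$ for such a network on $\mathbb{R}^q$ with $l$ hidden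 units; the pairs $(\theta_f,\theta_g)$ range over $\mathbb{R}^k$, $k=m(p+2)+l(q+2)$. For $\Theta\subset\mathbb{R}^k$ define the empirical neural HGR estimate $$\widehat{HGR}_{n}=\sup_{(\theta_f,\theta_g)\in\Theta}\rho_n\big(f_{\theta_f}(U),g_{\theta_g}(V)\big),$$ where $$\rho_n(X,Y)=\frac{E_n(XY)-E_n(X)E_n(Y)}{\sqrt{E_n(X^2)-E_n(X)^2}\,\sqrt{E_n(Y^2)-E_n(Y)^2}}$$ is the sample correlation, and $E_n$ denotes the empirical mean over the first $n$ samples. Then $\widehat{HGR}_n$ is strongly consistent: for every $\varepsilon>0$ there are numbers $m,l$ of hidden units and a compact set $\Theta\subset\mathbb{R}^k$ with nonempty interior such that, almost surely, there is an $N$ such that for all $n\ge N$ all sample variances of $f_{\theta_f}(U)$ and $g_{\theta_g}(V)$, $(\theta_f,\theta_g)\in\Theta$, are positive (so that $\widehat{HGR}_n$ is well defined) and $$\big|HGR(U,V)-\widehat{HGR}_n\big|\le\varepsilon .$$ -/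

import Mathlib

open MeasureTheory ProbabilityTheory Filter Topology

noncomputable section

/-- Pearson linear correlation coefficient of two real random variables
(meaningful when both have positive and finite variance). -/
def pearsonCorr {Ω : Type*} [MeasurableSpace Ω] (P : Measure Ω) (X Y : Ω → ℝ) : ℝ :=
  covariance X Y P / (Real.sqrt (variance X P) * Real.sqrt (variance Y P))

/-- The real random variable `X` has positive and finite variance. -/
def HasPosFiniteVariance {Ω : Type*} [MeasurableSpace Ω] (P : Measure Ω) (X : Ω → ℝ) : Prop :=
  MemLp X 2 P ∧ 0 < variance X P

/-- Hirschfeld-Gebelein-Rényi maximal correlation of `U` and `V`: the supremum of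
`ρ(f(U), g(V))` over measurable `f`, `g` such that `f(U)` and `g(V)` have positive and
finite variance. By Cauchy-Schwarz the set is bounded above by `1`; it is nonempty as
soon as `U` and `V` are not almost surely constant. -/
def HGR {Ω E F : Type*} [MeasurableSpace Ω] [MeasurableSpace E] [MeasurableSpace F]
    (P : Measure Ω) (U : Ω → E) (V : Ω → F) : ℝ :=
  sSup {r : ℝ | ∃ (f : E → ℝ) (g : F → ℝ), Measurable f ∧ Measurable g ∧
    HasPosFiniteVariance P (fun ω => f (U ω)) ∧ HasPosFiniteVariance P (fun ω => g (V ω)) ∧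
    r = pearsonCorr P (fun ω => f (U ω)) (fun ω => g (V ω))}

/-- A squashing function: nondecreasing with limits `0` at `-∞` and `1` at `+∞`. -/
def IsSquashing (σ : ℝ → ℝ) : Prop :=
  Monotone σ ∧ Tendsto σ atBot (𝓝 0) ∧ Tendsto σ atTop (𝓝 1)

/-- Parameters of a network with input in `ℝ^d` and one hidden layer of `m` units:
input weights `a₁, …, aₘ ∈ ℝ^d`, biases `b ∈ ℝ^m` and output weights `c ∈ ℝ^m`;
this is the space `ℝ^(m * (d + 2))`. -/
abbrev NetParam (d m : ℕ) : Type :=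
  (Fin m → EuclideanSpace ℝ (Fin d)) × (Fin m → ℝ) × (Fin m → ℝ)

/-- The feedforward neural network with activation function `σ`, one hidden layer and a
linear output unit: `u ↦ ∑ j, c j * σ (⟨a j, u⟩ + b j)`. -/
def network (σ : ℝ → ℝ) {d m : ℕ} (θ : NetParam d m) (u : EuclideanSpace ℝ (Fin d)) : ℝ :=
  ∑ j : Fin m, θ.2.2 j * σ (inner ℝ (θ.1 j) u + θ.2.1 j)

/-- Empirical expectation `Eₙ` of the first `n` terms of a sequence. -/
def sampleMean (n : ℕ) (x : ℕ → ℝ) : ℝ :=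
  (∑ i ∈ Finset.range n, x i) / n

/-- Sample covariance `Eₙ(XY) - Eₙ(X) Eₙ(Y)`. -/
def sampleCov (n : ℕ) (x y : ℕ → ℝ) : ℝ :=
  sampleMean n (fun i => x i * y i) - sampleMean n x * sampleMean n y

/-- Sample variance `Eₙ(X²) - Eₙ(X)²`. -/
def sampleVar (n : ℕ) (x : ℕ → ℝ) : ℝ :=
  sampleMean n (fun i => x i ^ 2) - sampleMean n x ^ 2

/-- Sample correlation `ρₙ` (meaningful when both sample variances are positive). -/
def sampleCorr (n : ℕ) (x y : ℕ → ℝ) : ℝ :=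
  sampleCov n x y / (Real.sqrt (sampleVar n x) * Real.sqrt (sampleVar n y))

/-- Empirical neural HGR estimate from the first `n` terms of the sample `(u i, v i)`: the
supremum of the sample correlations of `f_θf(u)` and `g_θg(v)` over `(θf, θg) ∈ Θ`.
Sample correlations are at most `1`, so this is a genuine supremum when `Θ` is nonempty. -/
def empiricalHGR (σ : ℝ → ℝ) {p q m l : ℕ} (Θ : Set (NetParam p m × NetParam q l)) (n : ℕ)
    (u : ℕ → EuclideanSpace ℝ (Fin p)) (v : ℕ → EuclideanSpace ℝ (Fin q)) : ℝ :=
  sSup {r : ℝ | ∃ θ ∈ Θ, r = sampleCorr n (fun i => network σ θ.1 (u i))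
    (fun i => network σ θ.2 (v i))}

end

/-! The error splits into approximation and estimation, each at most `ε / 2`. Correlation is
continuous on `L²` where the variances are positive, and networks are dense in `L²` of the laws of
`U` and `V`, so some pair of networks has correlation above `HGR - ε / 2`. `Θ` is a closed ball
around its parameters, small enough that all population variances stay positive. On this compact set
sample correlations converge uniformly. Since no population correlation exceeds `HGR`, the supremum
over `Θ` is squeezed from both sides.

Density (`dense_network`) is a duality argument: if `w` is orthogonal to every ridge function, then
the positive and negative parts of `w` are densities of two finite measures with equal ridge
integrals, and such measures coincide by a Cramér–Wold argument. Uniform convergence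
(`ae_eventually_sampleCorr`) comes from the strong law in the Banach space `C(T, ℝ)`. -/

/-! ### Density of one-hidden-layer networks in `L²` -/

section RidgeDensity

lemma IsSquashing.nonneg {σ : ℝ → ℝ} (hσ : IsSquashing σ) (x : ℝ) : 0 ≤ σ x :=
  hσ.1.le_of_tendsto hσ.2.1 x

lemma IsSquashing.le_one {σ : ℝ → ℝ} (hσ : IsSquashing σ) (x : ℝ) : σ x ≤ 1 :=
  hσ.1.ge_of_tendsto hσ.2.2 x

lemma IsSquashing.norm_le_one {σ : ℝ → ℝ} (hσ : IsSquashing σ) (x : ℝ) : ‖σ x‖ ≤ 1 := by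
  rw [Real.norm_eq_abs, abs_of_nonneg (hσ.nonneg x)]
  exact hσ.le_one x

/-- The extra shift `√n` is negligible against the dilation `n`, so it does not move the threshold
`t`, but it drives the argument to `+∞` at `y = t`. The limit there is thus `1`, whatever `σ 0` is.
-/
lemma IsSquashing.tendsto_indicator_Ici {σ : ℝ → ℝ} (hσ : IsSquashing σ) (t y : ℝ) :
    Tendsto (fun n : ℕ => σ ((n : ℝ) * y + (√(n : ℝ) - (n : ℝ) * t))) atTop
      (𝓝 ((Set.Ici t).indicator 1 y)) := by
  have hs : Tendsto (fun n : ℕ => √(n : ℝ)) atTop atTop :=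
    Real.tendsto_sqrt_atTop.comp tendsto_natCast_atTop_atTop
  have heq : ∀ n : ℕ, (n : ℝ) * y + (√(n : ℝ) - (n : ℝ) * t)
      = √(n : ℝ) * (√(n : ℝ) * (y - t) + 1) := fun n => by
    have := Real.mul_self_sqrt (Nat.cast_nonneg (α := ℝ) n)
    linear_combination (t - y) * this
  simp_rw [heq]
  by_cases h : t ≤ y
  · rw [Set.indicator_of_mem (by exact h), Pi.one_apply]
    refine hσ.2.2.comp (tendsto_atTop_mono (fun n => ?_) hs)
    have h1 := Real.sqrt_nonneg (n : ℝ)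
    exact le_mul_of_one_le_right h1
      (le_add_of_nonneg_left (mul_nonneg h1 (sub_nonneg.2 h)))
  · rw [Set.indicator_of_notMem (by simpa using h)]
    refine hσ.2.1.comp (hs.atTop_mul_atBot₀ (tendsto_atBot_add_const_right _ _ ?_))
    exact hs.atTop_mul_const_of_neg (sub_neg.2 (not_le.1 h))

lemma integrable_squashing_comp {α : Type*} [MeasurableSpace α] {μ : Measure α} [IsFiniteMeasure μ]
    {σ : ℝ → ℝ} (hσ : IsSquashing σ) {g : α → ℝ} (hg : Measurable g) :
    Integrable (fun x => σ (g x)) μ :=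
  Integrable.of_bound (hσ.1.measurable.comp hg).aestronglyMeasurable 1
    (Eventually.of_forall fun _ => hσ.norm_le_one _)

lemma measure_real_eq_of_integral_squashing_eq {σ : ℝ → ℝ} (hσ : IsSquashing σ)
    {μ ν : Measure ℝ} [IsFiniteMeasure μ] [IsFiniteMeasure ν]
    (h : ∀ a b : ℝ, ∫ y, σ (a * y + b) ∂μ = ∫ y, σ (a * y + b) ∂ν) : μ = ν := by
  have key : ∀ (ρ : Measure ℝ) [IsFiniteMeasure ρ] (t : ℝ),
      Tendsto (fun n : ℕ => ∫ y, σ ((n : ℝ) * y + (√(n : ℝ) - (n : ℝ) * t)) ∂ρ) atTop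
        (𝓝 (ρ.real (Set.Ici t))) := by
    intro ρ _ t
    rw [← integral_indicator_one measurableSet_Ici]
    refine tendsto_integral_of_dominated_convergence (fun _ => 1) (fun n => ?_)
      (integrable_const _) (fun n => Eventually.of_forall fun _ => hσ.norm_le_one _)
      (Eventually.of_forall fun y => hσ.tendsto_indicator_Ici t y)
    exact (integrable_squashing_comp hσ (by fun_prop)).aestronglyMeasurable
  refine Measure.ext_of_Ici μ ν fun t => ?_
  have := tendsto_nhds_unique (key μ t) (by simpa only [h] using key ν t)
  exact (measureReal_eq_measureReal_iff).1 this

variable {E : Type*} [NormedAddCommGroup E] [InnerProductSpace ℝ E] [MeasurableSpace E]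
  [BorelSpace E] [SecondCountableTopology E]

/-- Cramér–Wold: rescaled ridge integrals in direction `a` determine the projection of the measure
onto `a`, and the characteristic function at `a` depends only on that projection. -/
lemma measure_eq_of_integral_ridge_eq [CompleteSpace E] {σ : ℝ → ℝ} (hσ : IsSquashing σ)
    {μ ν : Measure E} [IsFiniteMeasure μ] [IsFiniteMeasure ν]
    (h : ∀ (a : E) (b : ℝ), ∫ x, σ (inner ℝ a x + b) ∂μ = ∫ x, σ (inner ℝ a x + b) ∂ν) :
    μ = ν := by
  have hmap : ∀ a : E, μ.map (fun x => inner ℝ x a) = ν.map (fun x => inner ℝ x a) := by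
    intro a
    refine measure_real_eq_of_integral_squashing_eq hσ fun s b => ?_
    rw [integral_map (by fun_prop)
        (integrable_squashing_comp hσ (by fun_prop)).aestronglyMeasurable,
      integral_map (by fun_prop)
        (integrable_squashing_comp hσ (by fun_prop)).aestronglyMeasurable]
    simp_rw [real_inner_comm a]
    simpa only [real_inner_smul_left] using h (s • a) b
  refine Measure.ext_of_charFun (funext fun a => ?_)
  have key : ∀ ρ : Measure E, charFun ρ a
      = ∫ y : ℝ, Complex.exp (y * Complex.I) ∂(ρ.map (fun x => inner ℝ x a)) := fun ρ => by
    rw [charFun_apply, integral_map (by fun_prop) (by fun_prop)]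
  rw [key, key, hmap]

lemma ae_eq_zero_of_integral_mul_ridge_eq_zero [CompleteSpace E] {σ : ℝ → ℝ} (hσ : IsSquashing σ)
    {μ : Measure E} [IsFiniteMeasure μ] {w : E → ℝ} (hw : Integrable w μ)
    (h : ∀ (a : E) (b : ℝ), ∫ x, w x * σ (inner ℝ a x + b) ∂μ = 0) : w =ᵐ[μ] 0 := by
  have hp : AEMeasurable (fun x => ENNReal.ofReal (w x)) μ := hw.aemeasurable.ennreal_ofReal
  have hn : AEMeasurable (fun x => ENNReal.ofReal (-w x)) μ := hw.neg.aemeasurable.ennreal_ofReal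
  have hfp : ∫⁻ x, ENNReal.ofReal (w x) ∂μ < ⊤ :=
    (lintegral_ofReal_le_lintegral_enorm w).trans_lt hw.2
  have hfn : ∫⁻ x, ENNReal.ofReal (-w x) ∂μ < ⊤ := 
    (lintegral_ofReal_le_lintegral_enorm _).trans_lt hw.neg.2
  have : IsFiniteMeasure (μ.withDensity fun x => ENNReal.ofReal (w x)) :=
    isFiniteMeasure_withDensity hfp.ne
  have : IsFiniteMeasure (μ.withDensity fun x => ENNReal.ofReal (-w x)) :=
    isFiniteMeasure_withDensity hfn.ne
  have heq := measure_eq_of_integral_ridge_eq hσ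
    (μ := μ.withDensity fun x => ENNReal.ofReal (w x))
    (ν := μ.withDensity fun x => ENNReal.ofReal (-w x)) (fun a b => by
      rw [integral_withDensity_eq_integral_toReal_smul₀ hp (by simp),
        integral_withDensity_eq_integral_toReal_smul₀ hn (by simp), ← sub_eq_zero,
        ← integral_sub, ← h a b]
      · congr 1
        ext x
        simp only [smul_eq_mul, ← sub_mul]
        congr 1
        rcases le_total 0 (w x) with hx | hx
        · rw [ENNReal.toReal_ofReal hx, ENNReal.ofReal_of_nonpos (by linarith)]; simp
        · rw [ENNReal.ofReal_of_nonpos hx, ENNReal.toReal_ofReal (by linarith : 0 ≤ -w x)]; simp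
      all_goals
        refine Integrable.mul_bdd (c := 1) ?_
          (integrable_squashing_comp hσ (by fun_prop)).aestronglyMeasurable
          (Eventually.of_forall fun _ => hσ.norm_le_one _)
      · exact hw.real_toNNReal
      · exact hw.neg.real_toNNReal)
  rw [withDensity_eq_iff hp hn hfp.ne] at heq
  filter_upwards [heq] with x hx
  rcases le_total 0 (w x) with h0 | h0
  · rw [ENNReal.ofReal_of_nonpos (by linarith : -w x ≤ 0), ENNReal.ofReal_eq_zero] at hx
    exact le_antisymm hx h0
  · rw [ENNReal.ofReal_of_nonpos h0, eq_comm, ENNReal.ofReal_eq_zero] at hx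
    exact le_antisymm h0 (by simpa using hx)

lemma memLp_ridge {σ : ℝ → ℝ} (hσ : IsSquashing σ) (μ : Measure E) [IsFiniteMeasure μ]
    (a : E) (b : ℝ) : MemLp (fun x => σ (inner ℝ a x + b)) 2 μ :=
  MemLp.of_bound (integrable_squashing_comp hσ (by fun_prop)).aestronglyMeasurable 1
    (Eventually.of_forall fun _ => hσ.norm_le_one _)

lemma topologicalClosure_span_ridge [CompleteSpace E] {σ : ℝ → ℝ} (hσ : IsSquashing σ) (μ : Measure E)
    [IsFiniteMeasure μ] :
    (Submodule.span ℝ (Set.range fun ab : E × ℝ =>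
      (memLp_ridge hσ μ ab.1 ab.2).toLp)).topologicalClosure = ⊤ := by
  rw [Submodule.topologicalClosure_eq_top_iff, Submodule.eq_bot_iff]
  intro w hw
  have hw2 := Lp.memLp w
  rw [Lp.eq_zero_iff_ae_eq_zero]
  refine ae_eq_zero_of_integral_mul_ridge_eq_zero hσ (hw2.integrable (by norm_num)) fun a b => ?_
  have := (Submodule.mem_orthogonal _ _).1 hw _ (Submodule.subset_span ⟨(a, b), rfl⟩)
  rw [L2.inner_def] at this
  rw [← this]
  refine integral_congr_ae ?_
  filter_upwards [(memLp_ridge hσ μ a b).coeFn_toLp] with x hx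
  simp [hx]

lemma sum_smul_toLp {α ι : Type*} [MeasurableSpace α] {μ : Measure α} {f : ι → α → ℝ}
    (hf : ∀ i, MemLp (f i) 2 μ) (c : ι → ℝ) (s : Finset ι) :
    ∑ i ∈ s, c i • (hf i).toLp
      = (memLp_finsetSum s fun i _ => (hf i).const_mul (c i)).toLp := by
  classical
  induction s using Finset.induction_on with
  | empty => rfl
  | insert i s hi ih =>
    rw [Finset.sum_insert hi, ih]
    simp_rw [Finset.sum_insert hi]
    rfl

variable {d : ℕ}

lemma continuous_network {σ : ℝ → ℝ} (hσc : Continuous σ) {m : ℕ} :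
    Continuous fun z : NetParam d m × EuclideanSpace ℝ (Fin d) => network σ z.1 z.2 := by
  unfold network
  fun_prop

lemma memLp_network {σ : ℝ → ℝ} (hσ : IsSquashing σ) (μ : Measure (EuclideanSpace ℝ (Fin d)))
    [IsFiniteMeasure μ] {m : ℕ} (θ : NetParam d m) : MemLp (network σ θ) 2 μ :=
  memLp_finsetSum _ fun j _ => (memLp_ridge hσ μ (θ.1 j) (θ.2.1 j)).const_mul (θ.2.2 j)

/-- Networks with one hidden layer of squashing units are dense in `L²`. -/
theorem dense_network {σ : ℝ → ℝ} (hσ : IsSquashing σ)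
    (μ : Measure (EuclideanSpace ℝ (Fin d))) [IsFiniteMeasure μ] :
    Dense (Set.range fun θ : Σ m, NetParam d m => (memLp_network hσ μ θ.2).toLp) := by
  have h := topologicalClosure_span_ridge hσ μ
  rw [← Submodule.dense_iff_topologicalClosure_eq_top] at h
  refine h.mono fun w hw => ?_
  obtain ⟨m, c, g, rfl⟩ := Submodule.mem_span_set'.1 hw
  choose ab hab using fun i => (g i).2
  refine ⟨⟨m, fun i => (ab i).1, fun i => (ab i).2, c⟩, ?_⟩
  simp_rw [← hab]
  exact (sum_smul_toLp (fun i => memLp_ridge hσ μ (ab i).1 (ab i).2) c Finset.univ).symm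

end RidgeDensity

/-! ### Continuity of correlation and approximation by networks -/

section Correlation

variable {Ω : Type*} [MeasurableSpace Ω] {P : Measure Ω}

lemma covariance_congr_ae {X X' Y Y' : Ω → ℝ} (hX : X =ᵐ[P] X') (hY : Y =ᵐ[P] Y') :
    covariance X Y P = covariance X' Y' P := by
  unfold covariance
  rw [integral_congr_ae hX, integral_congr_ae hY]
  refine integral_congr_ae ?_
  filter_upwards [hX, hY] with x h1 h2
  rw [h1, h2]

lemma pearsonCorr_congr_ae {X X' Y Y' : Ω → ℝ} (hX : X =ᵐ[P] X') (hY : Y =ᵐ[P] Y') :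
    pearsonCorr P X Y = pearsonCorr P X' Y' := by
  unfold pearsonCorr
  rw [covariance_congr_ae hX hY, variance_congr hX, variance_congr hY]

variable [IsProbabilityMeasure P]

/-- The difference of the two variables, each scaled to unit variance, has variance `2 - 2ρ ≥ 0`. -/
lemma pearsonCorr_le_one {X Y : Ω → ℝ} (hX : HasPosFiniteVariance P X)
    (hY : HasPosFiniteVariance P Y) : pearsonCorr P X Y ≤ 1 := by
  have hx := Real.sqrt_pos.2 hX.2
  have hy := Real.sqrt_pos.2 hY.2
  have h := variance_nonneg
    (fun ω => (√(variance X P))⁻¹ * X ω - (√(variance Y P))⁻¹ * Y ω) P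
  rw [variance_fun_sub (hX.1.const_mul _) (hY.1.const_mul _), variance_const_mul,
    variance_const_mul, covariance_const_mul_left, covariance_const_mul_right, inv_pow, inv_pow,
    Real.sq_sqrt hX.2.le, Real.sq_sqrt hY.2.le, inv_mul_cancel₀ hX.2.ne',
    inv_mul_cancel₀ hY.2.ne'] at h
  have : pearsonCorr P X Y
      = (√(variance X P))⁻¹ * ((√(variance Y P))⁻¹ * covariance X Y P) := by
    unfold pearsonCorr
    field_simp
  rw [this]
  linarith

lemma continuous_covariance_Lp :
    Continuous fun z : Lp ℝ 2 P × Lp ℝ 2 P => covariance z.1 z.2 P := by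
  have h1 : MemLp (fun _ : Ω => (1 : ℝ)) 2 P := memLp_const 1
  have hI : ∀ f : Lp ℝ 2 P, ∫ ω, f ω ∂P = inner ℝ h1.toLp f := fun f => by
    rw [L2.inner_def]
    refine integral_congr_ae ?_
    filter_upwards [h1.coeFn_toLp] with ω hω
    simp
  have hC : ∀ z : Lp ℝ 2 P × Lp ℝ 2 P, covariance z.1 z.2 P
      = inner ℝ z.2 z.1 - inner ℝ h1.toLp z.1 * inner ℝ h1.toLp z.2 := fun z => by
    rw [covariance_eq_sub (Lp.memLp _) (Lp.memLp _), hI, hI, L2.inner_def]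
    rfl
  simp_rw [hC]
  fun_prop

lemma continuous_variance_Lp : Continuous fun f : Lp ℝ 2 P => variance f P := by
  have h : ∀ f : Lp ℝ 2 P, variance f P = covariance f f P := fun f =>
    (covariance_self (Lp.memLp f).aemeasurable).symm
  simp_rw [h]
  exact continuous_covariance_Lp.comp (continuous_id.prodMk continuous_id)

omit [IsProbabilityMeasure P] in
-- Carries approximation in `L²` of the law of `W` back to `L²(P)`; composition with `W` is an
-- isometry.
lemma exists_continuous_comp_Lp {α : Type*} [MeasurableSpace α] {μ : Measure α} {W : Ω → α}
    (hW : MeasurePreserving W P μ) :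
    ∃ A : Lp ℝ 2 μ → Lp ℝ 2 P, Continuous A ∧
      ∀ {h : α → ℝ} (hh : MemLp h 2 μ), A hh.toLp =ᵐ[P] fun ω => h (W ω) :=
  ⟨Lp.compMeasurePreserving W hW, (Lp.isometry_compMeasurePreserving hW).continuous,
    fun hh => (hh.comp_measurePreserving hW).coeFn_toLp⟩

variable {p q : ℕ} {U : Ω → EuclideanSpace ℝ (Fin p)} {V : Ω → EuclideanSpace ℝ (Fin q)}

/-- Network correlations approximate the correlation of arbitrary square integrable functions. -/
theorem exists_network_pearsonCorr_gt {σ : ℝ → ℝ} (hσ : IsSquashing σ)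
    (hU : Measurable U) (hV : Measurable V)
    {f : EuclideanSpace ℝ (Fin p) → ℝ} {g : EuclideanSpace ℝ (Fin q) → ℝ}
    (hf : Measurable f) (hg : Measurable g)
    (hfU : HasPosFiniteVariance P fun ω => f (U ω))
    (hgV : HasPosFiniteVariance P fun ω => g (V ω)) {r : ℝ}
    (hr : r < pearsonCorr P (fun ω => f (U ω)) (fun ω => g (V ω))) :
    ∃ (m l : ℕ) (θ : NetParam p m) (η : NetParam q l),
      HasPosFiniteVariance P (fun ω => network σ θ (U ω)) ∧
      HasPosFiniteVariance P (fun ω => network σ η (V ω)) ∧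
      r < pearsonCorr P (fun ω => network σ θ (U ω)) (fun ω => network σ η (V ω)) := by
  have hUm : MeasurePreserving U P (P.map U) := hU.measurePreserving P
  have hVm : MeasurePreserving V P (P.map V) := hV.measurePreserving P
  have : IsProbabilityMeasure (P.map U) := Measure.isProbabilityMeasure_map hU.aemeasurable
  have : IsProbabilityMeasure (P.map V) := Measure.isProbabilityMeasure_map hV.aemeasurable
  have hf2 : MemLp f 2 (P.map U) :=
    (memLp_map_measure_iff hf.aestronglyMeasurable hU.aemeasurable).2 hfU.1
  have hg2 : MemLp g 2 (P.map V) :=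
    (memLp_map_measure_iff hg.aestronglyMeasurable hV.aemeasurable).2 hgV.1
  obtain ⟨A, hA, hAe⟩ := exists_continuous_comp_Lp hUm
  obtain ⟨B, hB, hBe⟩ := exists_continuous_comp_Lp hVm
  have hvA : Continuous fun z : Lp ℝ 2 (P.map U) × Lp ℝ 2 (P.map V) => variance (A z.1) P :=
    continuous_variance_Lp.comp (hA.comp continuous_fst)
  have hvB : Continuous fun z : Lp ℝ 2 (P.map U) × Lp ℝ 2 (P.map V) => variance (B z.2) P :=
    continuous_variance_Lp.comp (hB.comp continuous_snd)
  have hc : Continuous fun z : Lp ℝ 2 (P.map U) × Lp ℝ 2 (P.map V) =>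
      covariance (A z.1) (B z.2) P :=
    continuous_covariance_Lp.comp
      ((hA.comp continuous_fst).prodMk (hB.comp continuous_snd))
  have h0A : 0 < variance (A hf2.toLp) P := by rw [variance_congr (hAe hf2)]; exact hfU.2
  have h0B : 0 < variance (B hg2.toLp) P := by rw [variance_congr (hBe hg2)]; exact hgV.2
  have hρ : ContinuousAt (fun z : Lp ℝ 2 (P.map U) × Lp ℝ 2 (P.map V) =>
      pearsonCorr P (A z.1) (B z.2)) (hf2.toLp, hg2.toLp) := by
    unfold pearsonCorr
    exact hc.continuousAt.div (hvA.sqrt.mul hvB.sqrt).continuousAt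
      (mul_pos (Real.sqrt_pos.2 h0A) (Real.sqrt_pos.2 h0B)).ne'
  have hρ0 : r < pearsonCorr P (A hf2.toLp) (B hg2.toLp) := by
    rwa [pearsonCorr_congr_ae (hAe hf2) (hBe hg2)]
  have e1 : ∀ᶠ z in 𝓝 (hf2.toLp, hg2.toLp), 0 < variance (A z.1) P :=
    (hvA.tendsto (hf2.toLp, hg2.toLp)).eventually_const_lt h0A
  have e2 : ∀ᶠ z in 𝓝 (hf2.toLp, hg2.toLp), 0 < variance (B z.2) P :=
    (hvB.tendsto (hf2.toLp, hg2.toLp)).eventually_const_lt h0B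
  have e3 : ∀ᶠ z in 𝓝 (hf2.toLp, hg2.toLp), r < pearsonCorr P (A z.1) (B z.2) :=
    hρ.tendsto.eventually_const_lt hρ0
  -- Density puts network pairs arbitrarily close to `(f, g)`, where the three open conditions hold.
  have hd := (mem_closure_iff_frequently.1 (((dense_network hσ (P.map U)).prod
    (dense_network hσ (P.map V))) (hf2.toLp, hg2.toLp))).and_eventually (e1.and (e2.and e3))
  obtain ⟨z, hz, h1, h2, h3⟩ := hd.exists
  obtain ⟨hz1, hz2⟩ := Set.mem_prod.1 hz
  obtain ⟨⟨m, θ⟩, hθ⟩ := Set.mem_range.1 hz1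
  obtain ⟨⟨l, η⟩, hη⟩ := Set.mem_range.1 hz2
  rw [← hθ] at h1 h3
  rw [← hη] at h2 h3
  rw [variance_congr (hAe (memLp_network hσ _ θ))] at h1
  rw [variance_congr (hBe (memLp_network hσ _ η))] at h2
  rw [pearsonCorr_congr_ae (hAe (memLp_network hσ _ θ)) (hBe (memLp_network hσ _ η))] at h3
  exact ⟨m, l, θ, η, ⟨(memLp_network hσ _ θ).comp_measurePreserving hUm, h1⟩,
    ⟨(memLp_network hσ _ η).comp_measurePreserving hVm, h2⟩, h3⟩

lemma exists_coord_hasPosFiniteVariance {K : Set (EuclideanSpace ℝ (Fin p))} (hK : IsCompact K)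
    (hU : Measurable U) (hUK : ∀ᵐ ω ∂P, U ω ∈ K) (hUc : ¬ ∃ c, ∀ᵐ ω ∂P, U ω = c) :
    ∃ i, HasPosFiniteVariance P fun ω => U ω i := by
  by_contra! hcon
  obtain ⟨C, hC⟩ := hK.exists_bound_of_continuousOn continuousOn_id
  have hL : ∀ i, MemLp (fun ω => U ω i) 2 P := fun i => by
    refine MemLp.of_bound (by fun_prop) C ?_
    filter_upwards [hUK] with ω hω
    exact (PiLp.norm_apply_le _ i).trans (hC _ hω)
  have h0 : ∀ i, ∀ᵐ ω ∂P, U ω i = ∫ ω, U ω i ∂P := fun i =>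
    ae_eq_integral_of_variance_eq_zero (hL i)
      (le_antisymm (not_lt.1 fun h => hcon i ⟨hL i, h⟩) (variance_nonneg _ _))
  refine hUc ⟨WithLp.toLp 2 fun i => ∫ ω, U ω i ∂P, ?_⟩
  filter_upwards [ae_all_iff.2 h0] with ω hω
  ext i
  exact hω i

lemma pearsonCorr_le_HGR {f : EuclideanSpace ℝ (Fin p) → ℝ} {g : EuclideanSpace ℝ (Fin q) → ℝ}
    (hf : Measurable f) (hg : Measurable g)
    (hfU : HasPosFiniteVariance P fun ω => f (U ω))
    (hgV : HasPosFiniteVariance P fun ω => g (V ω)) :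
    pearsonCorr P (fun ω => f (U ω)) (fun ω => g (V ω)) ≤ HGR P U V := by
  refine le_csSup ⟨1, ?_⟩ ⟨f, g, hf, hg, hfU, hgV, rfl⟩
  rintro _ ⟨f, g, -, -, hf, hg, rfl⟩
  exact pearsonCorr_le_one hf hg

end Correlation

/-! ### Uniform strong law over a compact parameter space -/

section UniformLaw

variable {Ω Ω' T X : Type*} [MeasurableSpace Ω] [MeasurableSpace Ω'] {P : Measure Ω}
  {P' : Measure Ω'} [IsProbabilityMeasure P] [IsProbabilityMeasure P']
  [TopologicalSpace T] [CompactSpace T]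
  [TopologicalSpace X] [T2Space X] [MeasurableSpace X] [BorelSpace X] [SecondCountableTopology X]

omit [IsProbabilityMeasure P] in
/-- Uniform strong law of large numbers for a jointly continuous family of functions. -/
theorem ae_tendsto_sampleMean {F : T → X → ℝ} (hF : Continuous fun z : T × X => F z.1 z.2)
    {S : ℕ → Ω' → X} (hSm : ∀ i, Measurable (S i)) (hSi : iIndepFun S P') {W : Ω → X}
    (hSd : ∀ i, IdentDistrib (S i) W P' P) {K : Set X} (hK : IsCompact K)
    (hWK : ∀ᵐ ω ∂P, W ω ∈ K) :
    ∀ᵐ ω ∂P', ∀ t : T, Tendsto (fun z : ℕ × T => sampleMean z.1 fun i => F z.2 (S i ω))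
      (atTop ×ˢ 𝓝 t) (𝓝 (∫ ω, F t (W ω) ∂P)) := by
  borelize C(T, ℝ)
  -- Currying makes each sample a random element of `C(T, ℝ)`, so the Banach-valued strong law gives
  -- convergence uniform in `t`.
  let G : C(X, C(T, ℝ)) := ContinuousMap.curry ⟨fun z => F z.2 z.1, hF.comp continuous_swap⟩
  have hGm : Measurable G := G.continuous.measurable
  obtain ⟨C, hC⟩ := hK.exists_bound_of_continuousOn G.continuous.continuousOn
  have hint : Integrable (fun ω => G (S 0 ω)) P' := by
    refine Integrable.of_bound
      ((G.continuous.stronglyMeasurable.comp_measurable (hSm 0)).aestronglyMeasurable) C ?_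
    filter_upwards [(hSd 0).symm.ae_mem_snd hK.isClosed.measurableSet hWK] with ω hω using hC _ hω
  have hlaw := strong_law_ae (fun i ω => G (S i ω)) hint
    (fun i j hij => (hSi.indepFun hij).comp hGm hGm) (fun i => ((hSd i).trans (hSd 0).symm).comp hGm)
  filter_upwards [hlaw] with ω hω t
  -- Evaluation is jointly continuous, so the limit may be taken in `n` and the parameter together.
  have hev : Tendsto (fun z : C(T, ℝ) × T => z.1 z.2) (𝓝 (∫ ω, G (S 0 ω) ∂P') ×ˢ 𝓝 t)
      (𝓝 ((∫ ω, G (S 0 ω) ∂P') t)) := by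
    rw [← nhds_prod_eq]
    exact (ContinuousEval.continuous_eval (F := C(T, ℝ))).tendsto (_, t)
  have hlim : (∫ ω, G (S 0 ω) ∂P') t = ∫ ω, F t (W ω) ∂P :=
    ((ContinuousMap.evalCLM ℝ t).integral_comp_comm hint).symm.trans
      ((hSd 0).comp (hF.comp (Continuous.prodMk_right t)).measurable).integral_eq
  rw [← hlim]
  refine (hev.comp (hω.prodMap tendsto_id)).congr fun z => ?_
  simp [sampleMean, G, div_eq_inv_mul]

omit [CompactSpace T] [SecondCountableTopology X] [IsProbabilityMeasure P] in
lemma continuous_integral_comp [IsFiniteMeasure P] [FirstCountableTopology T]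
    [LocallyCompactSpace T]
    {F : T → X → ℝ} (hF : Continuous fun z : T × X => F z.1 z.2)
    {W : Ω → X} (hW : Measurable W) {K : Set X} (hK : IsCompact K) (hWK : ∀ᵐ ω ∂P, W ω ∈ K) :
    Continuous fun t => ∫ ω, F t (W ω) ∂P := by
  have hr : (P.map W).restrict K = P.map W :=
    Measure.restrict_eq_self_of_ae_mem
      ((ae_map_iff hW.aemeasurable hK.isClosed.measurableSet).2 hWK)
  have heq : ∀ t, ∫ ω, F t (W ω) ∂P = ∫ x in K, F t x ∂(P.map W) := fun t => by
    rw [hr, integral_map hW.aemeasurable]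
    exact (hF.comp (Continuous.prodMk_right t)).aestronglyMeasurable
  simp_rw [heq]
  exact continuous_parametric_integral_of_continuous hF hK

omit [CompactSpace T] [SecondCountableTopology X] [T2Space X] in
lemma memLp_two_comp {F : T → X → ℝ} (hF : Continuous fun z : T × X => F z.1 z.2)
    {W : Ω → X} (hW : Measurable W) {K : Set X} (hK : IsCompact K) (hWK : ∀ᵐ ω ∂P, W ω ∈ K)
    (t : T) : MemLp (fun ω => F t (W ω)) 2 P := by
  have hFt : Continuous (F t) := hF.comp (Continuous.prodMk_right t)
  obtain ⟨C, hC⟩ := hK.exists_bound_of_continuousOn hFt.continuousOn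
  refine MemLp.of_bound (hFt.measurable.comp hW).aestronglyMeasurable C ?_
  filter_upwards [hWK] with ω hω using hC _ hω

omit [CompactSpace T] [SecondCountableTopology X] in
lemma continuous_covariance_comp [FirstCountableTopology T] [LocallyCompactSpace T]
    {F G : T → X → ℝ} (hF : Continuous fun z : T × X => F z.1 z.2)
    (hG : Continuous fun z : T × X => G z.1 z.2)
    {W : Ω → X} (hW : Measurable W) {K : Set X} (hK : IsCompact K) (hWK : ∀ᵐ ω ∂P, W ω ∈ K) :
    Continuous fun t => covariance (fun ω => F t (W ω)) (fun ω => G t (W ω)) P := by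
  simp_rw [covariance_eq_sub (memLp_two_comp hF hW hK hWK _) (memLp_two_comp hG hW hK hWK _)]
  exact (continuous_integral_comp (F := fun t x => F t x * G t x) (hF.mul hG) hW hK hWK).sub
    ((continuous_integral_comp hF hW hK hWK).mul (continuous_integral_comp hG hW hK hWK))

lemma sampleVar_eq_sampleCov (n : ℕ) (x : ℕ → ℝ) : sampleVar n x = sampleCov n x x := by
  simp only [sampleVar, sampleCov, pow_two]

/-- Uniform strong law for sample correlations. -/
theorem ae_eventually_sampleCorr [FirstCountableTopology T] [T2Space T]
    {F G : T → X → ℝ} (hF : Continuous fun z : T × X => F z.1 z.2)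
    (hG : Continuous fun z : T × X => G z.1 z.2)
    {S : ℕ → Ω' → X} (hSm : ∀ i, Measurable (S i)) (hSi : iIndepFun S P') {W : Ω → X}
    (hW : Measurable W) (hSd : ∀ i, IdentDistrib (S i) W P' P) {K : Set X} (hK : IsCompact K)
    (hWK : ∀ᵐ ω ∂P, W ω ∈ K) (hFv : ∀ t, 0 < variance (fun ω => F t (W ω)) P)
    (hGv : ∀ t, 0 < variance (fun ω => G t (W ω)) P) :
    ∀ᵐ ω ∂P', ∀ δ > 0, ∀ᶠ n in atTop, ∀ t,
      0 < sampleVar n (fun i => F t (S i ω)) ∧ 0 < sampleVar n (fun i => G t (S i ω)) ∧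
      |sampleCorr n (fun i => F t (S i ω)) (fun i => G t (S i ω))
        - pearsonCorr P (fun ω => F t (W ω)) (fun ω => G t (W ω))| < δ := by
  have hvar : ∀ {H : T → X → ℝ}, (Continuous fun z : T × X => H z.1 z.2) → ∀ t,
      variance (fun ω => H t (W ω)) P
        = covariance (fun ω => H t (W ω)) (fun ω => H t (W ω)) P := fun hH t =>
    (covariance_self (memLp_two_comp hH hW hK hWK t).aemeasurable).symm
  filter_upwards [ae_tendsto_sampleMean hF hSm hSi hSd hK hWK,
    ae_tendsto_sampleMean hG hSm hSi hSd hK hWK,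
    ae_tendsto_sampleMean (F := fun t x => F t x * F t x) (hF.mul hF)
      hSm hSi hSd hK hWK,
    ae_tendsto_sampleMean (F := fun t x => G t x * G t x) (hG.mul hG)
      hSm hSi hSd hK hWK,
    ae_tendsto_sampleMean (F := fun t x => F t x * G t x) (hF.mul hG)
      hSm hSi hSd hK hWK] with ω h1 h2 h11 h22 h12 δ hδ
  have key : ∀ t, ∀ᶠ z : ℕ × T in atTop ×ˢ 𝓝 t,
      0 < sampleVar z.1 (fun i => F z.2 (S i ω)) ∧ 0 < sampleVar z.1 (fun i => G z.2 (S i ω)) ∧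
      |sampleCorr z.1 (fun i => F z.2 (S i ω)) (fun i => G z.2 (S i ω))
        - pearsonCorr P (fun ω => F z.2 (W ω)) (fun ω => G z.2 (W ω))| < δ := by
    intro t
    have hFF : Tendsto (fun z : ℕ × T => sampleVar z.1 (fun i => F z.2 (S i ω)))
        (atTop ×ˢ 𝓝 t) (𝓝 (variance (fun ω => F t (W ω)) P)) := by
      rw [hvar hF, covariance_eq_sub (memLp_two_comp hF hW hK hWK t)
        (memLp_two_comp hF hW hK hWK t)]
      simp_rw [sampleVar_eq_sampleCov]
      exact (h11 t).sub ((h1 t).mul (h1 t))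
    have hGG : Tendsto (fun z : ℕ × T => sampleVar z.1 (fun i => G z.2 (S i ω)))
        (atTop ×ˢ 𝓝 t) (𝓝 (variance (fun ω => G t (W ω)) P)) := by
      rw [hvar hG, covariance_eq_sub (memLp_two_comp hG hW hK hWK t)
        (memLp_two_comp hG hW hK hWK t)]
      simp_rw [sampleVar_eq_sampleCov]
      exact (h22 t).sub ((h2 t).mul (h2 t))
    have hFG : Tendsto
        (fun z : ℕ × T => sampleCov z.1 (fun i => F z.2 (S i ω)) (fun i => G z.2 (S i ω)))
        (atTop ×ˢ 𝓝 t) (𝓝 (covariance (fun ω => F t (W ω)) (fun ω => G t (W ω)) P)) := by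
      rw [covariance_eq_sub (memLp_two_comp hF hW hK hWK t) (memLp_two_comp hG hW hK hWK t)]
      exact (h12 t).sub ((h1 t).mul (h2 t))
    have hne : √(variance (fun ω => F t (W ω)) P) * √(variance (fun ω => G t (W ω)) P) ≠ 0 :=
      (mul_pos (Real.sqrt_pos.2 (hFv t)) (Real.sqrt_pos.2 (hGv t))).ne'
    have hρn : Tendsto
        (fun z : ℕ × T => sampleCorr z.1 (fun i => F z.2 (S i ω)) (fun i => G z.2 (S i ω)))
        (atTop ×ˢ 𝓝 t) (𝓝 (pearsonCorr P (fun ω => F t (W ω)) (fun ω => G t (W ω)))) :=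
      hFG.div (hFF.sqrt.mul hGG.sqrt) hne
    have hρ : Tendsto (fun z : ℕ × T => pearsonCorr P (fun ω => F z.2 (W ω))
          (fun ω => G z.2 (W ω)))
        (atTop ×ˢ 𝓝 t) (𝓝 (pearsonCorr P (fun ω => F t (W ω)) (fun ω => G t (W ω)))) := by
      have hvF := continuous_covariance_comp hF hF hW hK hWK
      have hvG := continuous_covariance_comp hG hG hW hK hWK
      simp_rw [← hvar hF] at hvF
      simp_rw [← hvar hG] at hvG
      have hc : ContinuousAt (fun t => pearsonCorr P (fun ω => F t (W ω))
          (fun ω => G t (W ω))) t :=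
        (continuous_covariance_comp hF hG hW hK hWK).continuousAt.div
          (hvF.sqrt.mul hvG.sqrt).continuousAt hne
      exact hc.tendsto.comp tendsto_snd
    have hdiff := (hρn.sub hρ).abs
    rw [sub_self, abs_zero] at hdiff
    filter_upwards [hFF.eventually_const_lt (hFv t), hGG.eventually_const_lt (hGv t),
      hdiff.eventually_lt_const hδ] with z hz1 hz2 hz3 using ⟨hz1, hz2, hz3⟩
  -- Compactness of `T` merges the local statements near each `t` into one threshold for `n`.
  have := isCompact_univ.mem_prod_nhdsSet_of_forall fun t (_ : t ∈ Set.univ) => key t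
  rw [nhdsSet_univ] at this
  filter_upwards [Eventually.curry this] with n hn t
  exact eventually_top.1 hn t

end UniformLaw

/-! ### Choice of `Θ` and the two-sided bound -/

theorem theorem1
    {Ω Ω' : Type*} [MeasurableSpace Ω] [MeasurableSpace Ω']
    (P : Measure Ω) [IsProbabilityMeasure P] (P' : Measure Ω') [IsProbabilityMeasure P']
    {p q : ℕ}
    -- the random variables, with compact domains and not almost surely constant
    (U : Ω → EuclideanSpace ℝ (Fin p)) (V : Ω → EuclideanSpace ℝ (Fin q))
    (hU : Measurable U) (hV : Measurable V)
    (KU : Set (EuclideanSpace ℝ (Fin p))) (KV : Set (EuclideanSpace ℝ (Fin q)))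
    (hKU : IsCompact KU) (hKV : IsCompact KV)
    (hUK : ∀ᵐ ω ∂P, U ω ∈ KU) (hVK : ∀ᵐ ω ∂P, V ω ∈ KV)
    (hUc : ¬ ∃ c, ∀ᵐ ω ∂P, U ω = c) (hVc : ¬ ∃ c, ∀ᵐ ω ∂P, V ω = c)
    -- an i.i.d. sequence of samples of the pair
    (S : ℕ → Ω' → EuclideanSpace ℝ (Fin p) × EuclideanSpace ℝ (Fin q))
    (hSm : ∀ i, Measurable (S i)) (hSi : iIndepFun S P')
    (hSd : ∀ i, IdentDistrib (S i) (fun ω => (U ω, V ω)) P' P)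
    -- the activation function
    (σ : ℝ → ℝ) (hσc : Continuous σ) (hσ : IsSquashing σ)
    (ε : ℝ) (hε : 0 < ε) :
    ∃ (m l : ℕ) (Θ : Set (NetParam p m × NetParam q l)),
      IsCompact Θ ∧ (interior Θ).Nonempty ∧
      ∀ᵐ ω ∂P', ∃ N : ℕ, ∀ n ≥ N,
        (∀ θ ∈ Θ, 0 < sampleVar n (fun i => network σ θ.1 (S i ω).1) ∧
          0 < sampleVar n (fun i => network σ θ.2 (S i ω).2)) ∧
        |HGR P U V - empiricalHGR σ Θ n (fun i => (S i ω).1) (fun i => (S i ω).2)| ≤ ε := by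
  obtain ⟨i, hi⟩ := exists_coord_hasPosFiniteVariance hKU hU hUK hUc
  obtain ⟨j, hj⟩ := exists_coord_hasPosFiniteVariance hKV hV hVK hVc
  have hne : {r : ℝ | ∃ (f : EuclideanSpace ℝ (Fin p) → ℝ) (g : EuclideanSpace ℝ (Fin q) → ℝ),
      Measurable f ∧ Measurable g ∧
      HasPosFiniteVariance P (fun ω => f (U ω)) ∧ HasPosFiniteVariance P (fun ω => g (V ω)) ∧
      r = pearsonCorr P (fun ω => f (U ω)) (fun ω => g (V ω))}.Nonempty :=
    -- Non-constancy enters here: nonconstant coordinates make the set defining `HGR` nonempty, so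
    -- its supremum can be approached.
    ⟨_, fun x => x i, fun x => x j, by fun_prop, by fun_prop, hi, hj, rfl⟩
  have hlt : HGR P U V - ε / 2 < HGR P U V := by linarith
  obtain ⟨_, ⟨f, g, hf, hg, hfU, hgV, rfl⟩, hr⟩ := exists_lt_of_lt_csSup hne hlt
  obtain ⟨m, l, θ₀, η₀, hθ₀, hη₀, hρ₀⟩ :=
    exists_network_pearsonCorr_gt hσ hU hV hf hg hfU hgV hr
  let Z := EuclideanSpace ℝ (Fin p) × EuclideanSpace ℝ (Fin q)
  let F : NetParam p m × NetParam q l → Z → ℝ := fun θ x => network σ θ.1 x.1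
  let G : NetParam p m × NetParam q l → Z → ℝ := fun θ x => network σ θ.2 x.2
  have hF : Continuous fun z : (NetParam p m × NetParam q l) × Z => F z.1 z.2 :=
    (continuous_network hσc).comp
      ((continuous_fst.comp continuous_fst).prodMk (continuous_fst.comp continuous_snd))
  have hG : Continuous fun z : (NetParam p m × NetParam q l) × Z => G z.1 z.2 :=
    (continuous_network hσc).comp
      ((continuous_snd.comp continuous_fst).prodMk (continuous_snd.comp continuous_snd))
  have hW : Measurable fun ω => (U ω, V ω) := hU.prodMk hV
  have hK : IsCompact (KU ×ˢ KV) := hKU.prod hKV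
  have hWK : ∀ᵐ ω ∂P, (U ω, V ω) ∈ KU ×ˢ KV := by
    filter_upwards [hUK, hVK] with ω h1 h2 using ⟨h1, h2⟩
  have hFc : Continuous fun θ => variance (fun ω => F θ (U ω, V ω)) P :=
    (continuous_covariance_comp hF hF hW hK hWK).congr fun θ =>
      covariance_self (memLp_two_comp hF hW hK hWK θ).aemeasurable
  have hGc : Continuous fun θ => variance (fun ω => G θ (U ω, V ω)) P :=
    (continuous_covariance_comp hG hG hW hK hWK).congr fun θ =>
      covariance_self (memLp_two_comp hG hW hK hWK θ).aemeasurable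
  have hFpos : ∀ᶠ θ in 𝓝 (θ₀, η₀), 0 < variance (fun ω => F θ (U ω, V ω)) P :=
    (hFc.tendsto (θ₀, η₀)).eventually_const_lt hθ₀.2
  have hGpos : ∀ᶠ θ in 𝓝 (θ₀, η₀), 0 < variance (fun ω => G θ (U ω, V ω)) P :=
    (hGc.tendsto (θ₀, η₀)).eventually_const_lt hη₀.2
  obtain ⟨R, hR, hball⟩ := Metric.nhds_basis_closedBall.eventually_iff.1 (hFpos.and hGpos)
  have hΘ : IsCompact (Metric.closedBall (θ₀, η₀) R) := isCompact_closedBall _ _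
  have h₀ : (θ₀, η₀) ∈ Metric.closedBall (θ₀, η₀) R := Metric.mem_closedBall_self hR.le
  refine ⟨m, l, Metric.closedBall (θ₀, η₀) R, hΘ,
    ⟨(θ₀, η₀), Metric.ball_subset_interior_closedBall (Metric.mem_ball_self hR)⟩, ?_⟩
  have : CompactSpace (Metric.closedBall (θ₀, η₀) R) := isCompact_iff_compactSpace.1 hΘ
  have hlaw := ae_eventually_sampleCorr (T := Metric.closedBall (θ₀, η₀) R)
    (F := fun θ => F θ) (G := fun θ => G θ)
    (hF.comp (continuous_subtype_val.prodMap continuous_id))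
    (hG.comp (continuous_subtype_val.prodMap continuous_id))
    hSm hSi hW hSd hK hWK (fun θ => (hball θ.2).1) (fun θ => (hball θ.2).2)
  filter_upwards [hlaw] with ω hω
  obtain ⟨N, hN⟩ := eventually_atTop.1 (hω (ε / 2) (half_pos hε))
  refine ⟨N, fun n hn => ⟨fun θ hθ => ⟨(hN n hn ⟨θ, hθ⟩).1, (hN n hn ⟨θ, hθ⟩).2.1⟩, ?_⟩⟩
  have hupper : ∀ θ ∈ Metric.closedBall (θ₀, η₀) R,
      sampleCorr n (fun i => network σ θ.1 (S i ω).1) (fun i => network σ θ.2 (S i ω).2)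
        ≤ HGR P U V + ε / 2 := by
    intro θ hθ
    have h1 := (abs_lt.1 (hN n hn ⟨θ, hθ⟩).2.2).2
    have h2 : pearsonCorr P (fun ω => network σ θ.1 (U ω)) (fun ω => network σ θ.2 (V ω))
        ≤ HGR P U V :=
      pearsonCorr_le_HGR
        ((continuous_network hσc).comp (Continuous.prodMk_right θ.1)).measurable
        ((continuous_network hσc).comp (Continuous.prodMk_right θ.2)).measurable
        ⟨memLp_two_comp hF hW hK hWK θ, (hball hθ).1⟩
        ⟨memLp_two_comp hG hW hK hWK θ, (hball hθ).2⟩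
    linarith
  have hle : empiricalHGR σ (Metric.closedBall (θ₀, η₀) R) n (fun i => (S i ω).1)
      (fun i => (S i ω).2) ≤ HGR P U V + ε / 2 := by
    refine csSup_le ⟨_, _, h₀, rfl⟩ ?_
    rintro _ ⟨θ, hθ, rfl⟩
    exact hupper θ hθ
  have hge : sampleCorr n (fun i => network σ θ₀ (S i ω).1) (fun i => network σ η₀ (S i ω).2)
      ≤ empiricalHGR σ (Metric.closedBall (θ₀, η₀) R) n (fun i => (S i ω).1)
        (fun i => (S i ω).2) := by
    refine le_csSup ⟨HGR P U V + ε / 2, ?_⟩ ⟨_, h₀, rfl⟩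
    rintro _ ⟨θ, hθ, rfl⟩
    exact hupper θ hθ
  -- The centre of the ball alone gives the lower bound, losing `ε / 2` to approximation and `ε / 2`
  -- to sampling.
  have h3 := (abs_lt.1 (hN n hn ⟨_, h₀⟩).2.2).1
  rw [abs_le]
  constructor <;> linarith
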